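/- There exist a nonempty, open, bounded, strictly convex domain $\Omega\subset\mathbb R^2$ (strictly convex meaning that its closure $\overline\Omega$ is a strictly convex set), whose boundary is of class $C^k$ for some $k\ge 3$ and has no contact of order $k-1$ with its tangents, and a subset $\Gamma\subset\partial\Omega$ such that, for every speed of propagation $c>0$, both $\Gamma$ and $\partial\Omega\setminus\Gamma$ satisfy the geometric control condition. Here a ray of the optic geometry of $\Omega$ on a time interval $(0,T)$ is a curve $x:(0,T)\to\overline\Omega$ such that near each time $t$ one of the following holds: (i) $x(t)\in\Omega$ and $x$ moves in a straight line at speed $c$; (ii) $x(t)\in\partial\Omega$, $x$ arrives in a straight line with a velocity $v$, $|v|=c$, satisfying $\langle v,n\rangle>0$, and leaves in a straight line with velocity $v-2\langle v,n\rangle n$, where $n$ is the outward unit normal at $x(t)$ (the angle of reflection is equal to the angle of incidence); (iii) $x$ moves along $\partial\Omega$ at speed $c$ (gliding ray). A ray meets $\partial\Omega$ in a non-diffractive way at time $t$ if $x(t)\in\partial\Omega$ and the straight line continuing it from $x(t)$ with the incoming velocity leaves $\overline\Omega$ immediately. A set $\Gamma\subset\partial\Omega$ satisfies the geometric control condition if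 there is a $T>0$ such that every ray on $(0,T)$ meets, at some time $t\in(0,T)$ and in a non-diffractive way, the set $\Gamma$ in a point of its interior relative to $\partial\Omega$. -/

import Mathlib

open Set Filter Topology

/-- The Euclidean plane. -/
abbrev Plane : Type := EuclideanSpace ℝ (Fin 2)

/-- The boundary of `Ω` is of class `C^k` (it is the regular zero level of a `C^k` function `ρ`,
with `Ω = {ρ < 0}`) and has no contact of order `k - 1` with its tangents: along a tangent line
at a boundary point, some derivative of `ρ` of order at most `k - 1` does not vanish. -/
def HasRegularBoundary (k : ℕ) (Ω : Set Plane) : Prop :=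
  ∃ ρ : Plane → ℝ, ContDiff ℝ k ρ ∧ Ω = {y | ρ y < 0} ∧
    ∀ y ∈ frontier Ω, fderiv ℝ ρ y ≠ 0 ∧
      ∀ v : Plane, v ≠ 0 → fderiv ℝ ρ y v = 0 →
        ∃ j : ℕ, j ≤ k - 1 ∧ iteratedDeriv j (fun s : ℝ => ρ (y + s • v)) 0 ≠ 0

/-- Nonempty, open, bounded, strictly convex planar domains with a boundary of class `C^k`, for
some `k ≥ 3`, without contact of order `k - 1` with its tangents. For an open set,
`StrictConvex ℝ Ω` would only say that `Ω` is convex; strict convexity is a condition on the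
boundary, that is, on the closure. -/
structure IsStrictlyConvexDomain (Ω : Set Plane) : Prop where
  isOpen : IsOpen Ω
  nonempty : Ω.Nonempty
  bounded : Bornology.IsBounded Ω
  convex : Convex ℝ Ω
  strictConvex : StrictConvex ℝ (closure Ω)
  regular : ∃ k : ℕ, 3 ≤ k ∧ HasRegularBoundary k Ω

/-- `n` is an outward unit normal of the convex set `Ω` at the boundary point `y`. -/
def IsOutwardUnitNormal (Ω : Set Plane) (y n : Plane) : Prop :=
  ‖n‖ = 1 ∧ ∀ z ∈ Ω, inner ℝ (z - y) n ≤ 0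

/-- Near time `t` the curve `x` is inside `Ω` and travels in straight line at speed `c`. -/
def IsFreeAt (Ω : Set Plane) (c : ℝ) (x : ℝ → Plane) (t : ℝ) : Prop :=
  x t ∈ Ω ∧ ∃ v : Plane, ‖v‖ = c ∧ ∀ᶠ s in 𝓝 t, x s = x t + (s - t) • v

/-- At time `t` the curve `x` hits the boundary transversally, with incoming velocity `v` of
norm `c`, and is reflected: the angle of reflection is equal to the angle of incidence. -/
def IsReflectedAt (Ω : Set Plane) (c : ℝ) (x : ℝ → Plane) (t : ℝ) : Prop :=
  x t ∈ frontier Ω ∧ ∃ n v : Plane, IsOutwardUnitNormal Ω (x t) n ∧ ‖v‖ = c ∧ 0 < inner ℝ v n ∧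
    (∀ᶠ s in 𝓝[≤] t, x s = x t + (s - t) • v) ∧
    (∀ᶠ s in 𝓝[≥] t, x s = x t + (s - t) • (v - (2 * inner ℝ v n) • n))

/-- Near time `t` the curve `x` glides along the boundary at constant speed `c`. -/
def IsGlidingAt (Ω : Set Plane) (c : ℝ) (x : ℝ → Plane) (t : ℝ) : Prop :=
  ∀ᶠ s in 𝓝 t, x s ∈ frontier Ω ∧ DifferentiableAt ℝ x s ∧ ‖deriv x s‖ = c

/-- Rays of the optic geometry of `Ω` (speed of propagation `c`) on the time interval `(0, T)`. -/
def IsRay (Ω : Set Plane) (c T : ℝ) (x : ℝ → Plane) : Prop :=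
  ∀ t ∈ Ioo 0 T, IsFreeAt Ω c x t ∨ IsReflectedAt Ω c x t ∨ IsGlidingAt Ω c x t

/-- At time `t` the curve `x` meets the boundary in a non-diffractive way: continued in straight
line with the incoming velocity, it leaves the closure of `Ω` at once. -/
def IsNondiffractiveAt (Ω : Set Plane) (x : ℝ → Plane) (t : ℝ) : Prop :=
  x t ∈ frontier Ω ∧ ∃ v : Plane, HasDerivWithinAt x v (Iio t) t ∧
    ∀ᶠ s in 𝓝[>] (0 : ℝ), x t + s • v ∉ closure Ω

/-- The interior of `Γ` relative to the boundary of `Ω`. -/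
def boundaryInterior (Ω Γ : Set Plane) : Set Plane :=
  {y | y ∈ frontier Ω ∧ Γ ∈ 𝓝[frontier Ω] y}

/-- The geometric control condition: in some time `T`, every ray meets `Γ` in a non-diffractive
way. The condition is one on open portions of the boundary; for an arbitrary subset `Γ` of the
boundary the meeting is required to take place in the interior of `Γ` relative to the boundary
(all of `Γ` if `Γ` is relatively open), so that single boundary points do not matter. -/
def GeometricControlCondition (Ω : Set Plane) (c : ℝ) (Γ : Set Plane) : Prop :=
  ∃ T : ℝ, 0 < T ∧ ∀ x : ℝ → Plane, IsRay Ω c T x →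
    ∃ t ∈ Ioo 0 T, x t ∈ boundaryInterior Ω Γ ∧ IsNondiffractiveAt Ω x t

/-! In the coordinates X = p 0 + p 1 / 2 and Y = p 1 the domain is the unit disc, so in the plane it
is a centrally symmetric ellipse with tilted axes. The set `Γ` is the open arc Y > 0. The diameter Y
= 0 is not an axis and meets the boundary obliquely, which prevents a ray from bouncing along it
forever.

The arc Y ≤ 0 is parametrized by `stereoParam`, with values in [-1, 1]. By
`inner_ellipseTangent_pos`, a chord to a point of larger parameter makes an acute angle with the
tangent at its starting point, even when the chord is the whole diameter. A reflection preserves the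
tangential velocity, so a ray bouncing on this arc that moves towards smaller parameters continues
to do so (`IsFlight.no_left_turn`). Its parameters therefore increase and then decrease, with total
variation at most 4. Chords have length at most 3 times the parameter difference, so the stay lasts
at most 12 / c. Since reflections cannot accumulate inside the time interval, the ray reaches Y > 0
(`IsRay.exists_reflection_pos`). A gliding ray gets there because its parameter moves at speed at
least c / 3. The arc Y < 0 follows from the symmetry p ↦ -p. -/

/-- The bilinear form of the ellipse. -/
noncomputable def ellipseForm (u v : Plane) : ℝ := (u 0 + u 1 / 2) * (v 0 + v 1 / 2) + u 1 * v 1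

/-- A domain bounded by an ellipse whose axes are tilted with respect to the coordinate axes. -/
def tiltedEllipse : Set Plane := {p | ellipseForm p p < 1}

/-- The tangent vector of the ellipse at one of its points. -/
noncomputable def ellipseTangent (p : Plane) : Plane := !₂[-p 1 - (p 0 + p 1 / 2) / 2, p 0 + p 1 / 2]

/-- The stereographic parameter of a point of the ellipse. -/
noncomputable def stereoParam (p : Plane) : ℝ := (p 0 + p 1 / 2) / (1 - p 1)

/-! ### The quadratic form, and the ellipse as an admissible domain. -/

lemma plane_inner (u v : Plane) : inner ℝ u v = u 0 * v 0 + u 1 * v 1 := by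
  simp [PiLp.inner_apply, Fin.sum_univ_two, mul_comm]

lemma plane_norm_sq (u : Plane) : ‖u‖ ^ 2 = u 0 ^ 2 + u 1 ^ 2 := by
  rw [EuclideanSpace.real_norm_sq_eq, Fin.sum_univ_two]

lemma norm_sq_le_ellipseForm (u : Plane) : ‖u‖ ^ 2 ≤ 2 * ellipseForm u u := by
  rw [plane_norm_sq, ellipseForm]
  nlinarith [sq_nonneg (u 0 + 3 / 2 * u 1), sq_nonneg (u 1)]

lemma ellipseForm_pos {u : Plane} (hu : u ≠ 0) : 0 < ellipseForm u u := by
  have h := norm_sq_le_ellipseForm u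
  have : 0 < ‖u‖ ^ 2 := by positivity
  linarith

lemma ellipseForm_line (u v : Plane) (s : ℝ) :
    ellipseForm (u + s • v) (u + s • v) =
      ellipseForm u u + 2 * s * ellipseForm u v + s ^ 2 * ellipseForm v v := by
  simp only [ellipseForm, PiLp.add_apply, PiLp.smul_apply, smul_eq_mul]
  ring

lemma contDiff_ellipseForm {n : WithTop ℕ∞} : ContDiff ℝ n fun p : Plane => ellipseForm p p := by
  unfold ellipseForm
  fun_prop

lemma continuous_ellipseForm : Continuous fun p : Plane => ellipseForm p p :=
  (contDiff_ellipseForm (n := 0)).continuous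

lemma isOpen_tiltedEllipse : IsOpen tiltedEllipse :=
  isOpen_lt continuous_ellipseForm continuous_const

lemma ellipseForm_le_of_mem_closure {p : Plane} (hp : p ∈ closure tiltedEllipse) :
    ellipseForm p p ≤ 1 :=
  closure_minimal (fun _ h => le_of_lt h)
    (isClosed_le continuous_ellipseForm continuous_const) hp

lemma ellipseForm_of_mem_frontier {p : Plane} (hp : p ∈ frontier tiltedEllipse) :
    ellipseForm p p = 1 := by
  rw [isOpen_tiltedEllipse.frontier_eq] at hp
  exact le_antisymm (ellipseForm_le_of_mem_closure hp.1) (not_lt.1 hp.2)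

lemma ellipseForm_combo_lt {x y : Plane} (hx : ellipseForm x x ≤ 1) (hy : ellipseForm y y ≤ 1)
    (hxy : x ≠ y) {a b : ℝ} (ha : 0 < a) (hb : 0 < b) (hab : a + b = 1) :
    ellipseForm (a • x + b • y) (a • x + b • y) < 1 := by
  have h := ellipseForm_pos (sub_ne_zero.2 hxy)
  have hb' : b = 1 - a := by linarith
  have key : ellipseForm (a • x + b • y) (a • x + b • y) =
      a * ellipseForm x x + b * ellipseForm y y - a * b * ellipseForm (x - y) (x - y) := by
    subst hb'
    simp only [ellipseForm, PiLp.add_apply, PiLp.smul_apply, PiLp.sub_apply, smul_eq_mul]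
    ring
  rw [key]
  have := mul_pos (mul_pos ha hb) h
  nlinarith

lemma hasRegularBoundary_tiltedEllipse : HasRegularBoundary 3 tiltedEllipse := by
  have hline : ∀ y v : Plane, (fun s : ℝ => ellipseForm (y + s • v) (y + s • v) - 1) =
      fun s : ℝ => ellipseForm y y - 1 + 2 * s * ellipseForm y v + s ^ 2 * ellipseForm v v := by
    intro y v
    funext s
    rw [ellipseForm_line]
    ring
  have hder1 : ∀ y v : Plane,
      deriv (fun s : ℝ => ellipseForm (y + s • v) (y + s • v) - 1) =
        fun s : ℝ => 2 * ellipseForm y v + 2 * s * ellipseForm v v := by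
    intro y v
    rw [hline]
    funext s
    have h : HasDerivAt (fun s : ℝ => ellipseForm y y - 1 + 2 * s * ellipseForm y v +
        s ^ 2 * ellipseForm v v) (0 + 2 * 1 * ellipseForm y v +
          ((2 : ℕ) * s ^ (2 - 1) * 1) * ellipseForm v v) s :=
      ((hasDerivAt_const s _).add (((hasDerivAt_id s).const_mul 2).mul_const _)).add
        (((hasDerivAt_id s).pow 2).mul_const _)
    rw [h.deriv]
    push_cast
    ring
  have hfd : ∀ y v : Plane, fderiv ℝ (fun p : Plane => ellipseForm p p - 1) y v =
      2 * ellipseForm y v := by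
    intro y v
    have hd : DifferentiableAt ℝ (fun p : Plane => ellipseForm p p - 1) y :=
      ((contDiff_ellipseForm (n := 1)).differentiable (by simp)).differentiableAt.sub_const 1
    have h := hd.lineDeriv_eq_fderiv (v := v)
    rw [← h, lineDeriv, hder1]
    ring
  refine ⟨fun p => ellipseForm p p - 1, contDiff_ellipseForm.sub contDiff_const, ?_, ?_⟩
  · ext p
    simp [tiltedEllipse]
  · intro y hy
    refine ⟨fun h => ?_, fun v hv _ => ⟨2, by norm_num, ?_⟩⟩
    -- Euler's identity: the radial derivative at a boundary point is 2.
    · have h1 := hfd y y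
      rw [h, ellipseForm_of_mem_frontier hy] at h1
      norm_num at h1
    · rw [iteratedDeriv_succ, iteratedDeriv_one, hder1]
      have h : HasDerivAt (fun s : ℝ => 2 * ellipseForm y v + 2 * s * ellipseForm v v)
          (0 + 2 * 1 * ellipseForm v v) 0 :=
        (hasDerivAt_const _ _).add (((hasDerivAt_id (0 : ℝ)).const_mul 2).mul_const _)
      rw [h.deriv]
      have := ellipseForm_pos hv
      linarith

lemma isStrictlyConvexDomain_tiltedEllipse : IsStrictlyConvexDomain tiltedEllipse where
  isOpen := isOpen_tiltedEllipse
  nonempty := ⟨0, by simp [tiltedEllipse, ellipseForm]⟩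
  bounded := by
    refine (Metric.isBounded_closedBall (x := (0 : Plane)) (r := 2)).subset fun p hp => ?_
    have h := norm_sq_le_ellipseForm p
    have h1 : ellipseForm p p < 1 := hp
    rw [mem_closedBall_zero_iff]
    nlinarith [norm_nonneg p]
  convex := by
    refine convex_iff_forall_pos.2 fun x hx y hy a b ha hb hab => ?_
    rcases eq_or_ne x y with rfl | hxy
    · rwa [← add_smul, hab, one_smul]
    · exact ellipseForm_combo_lt (le_of_lt hx) (le_of_lt hy) hxy ha hb hab
  strictConvex := fun x hx y hy hxy a b ha hb hab =>
    interior_maximal subset_closure isOpen_tiltedEllipse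
      (ellipseForm_combo_lt (ellipseForm_le_of_mem_closure hx)
        (ellipseForm_le_of_mem_closure hy) hxy ha hb hab)
  regular := ⟨3, le_rfl, hasRegularBoundary_tiltedEllipse⟩

/-! ### Chords of the lower arc in the stereographic parameter. -/

lemma stereoParam_spec {p : Plane} (hp : ellipseForm p p = 1) (h1 : p 1 ≤ 0) :
    -1 ≤ stereoParam p ∧ stereoParam p ≤ 1 ∧
      p 0 + p 1 / 2 = 2 * stereoParam p / (1 + stereoParam p ^ 2) ∧
      p 1 = (stereoParam p ^ 2 - 1) / (1 + stereoParam p ^ 2) := by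
  have hd : 0 < 1 - p 1 := by linarith
  set X := p 0 + p 1 / 2 with hX
  have hc : X ^ 2 + p 1 ^ 2 = 1 := by rw [← hp, ellipseForm]; ring
  have hm : stereoParam p = X / (1 - p 1) := rfl
  have hsq : 1 + stereoParam p ^ 2 = 2 / (1 - p 1) := by
    rw [hm]; field_simp; nlinarith
  refine ⟨?_, ?_, ?_, ?_⟩
  · rw [hm, le_div_iff₀ hd]
    nlinarith
  · rw [hm, div_le_iff₀ hd]
    nlinarith
  · rw [hsq, hm]; field_simp
  · rw [hsq, hm]; field_simp; nlinarith

/-- This is where the tilt matters: for an untilted disc the diameter from parameter -1 to 1 would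
give the value 0. The reverse statement, for chords to smaller parameters, is not available, so one
turn remains possible. -/
lemma inner_ellipseTangent_pos {u v : Plane} (hu : ellipseForm u u = 1)
    (hv : ellipseForm v v = 1) (hu1 : u 1 ≤ 0) (hv1 : v 1 ≤ 0)
    (huv : stereoParam u < stereoParam v) : 0 < inner ℝ (v - u) (ellipseTangent u) := by
  obtain ⟨hs1, hs2, hsX, hsY⟩ := stereoParam_spec hu hu1
  obtain ⟨hm1, hm2, hmX, hmY⟩ := stereoParam_spec hv hv1
  set s := stereoParam u
  set m := stereoParam v
  -- The expression is affine in m; `h3` interpolates between its values at m = 1 (`h1`) and at m =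
  -- s (`h2`).
  have hF : 0 < (1 - s * m - (s + m) / 2) * (1 - s ^ 2 - s) + 2 * s * (s + m) := by
    have h1 : 0 < (1 / 2 + 3 * s ^ 2 + 3 / 2 * s ^ 3 : ℝ) := by
      nlinarith [mul_nonneg (sq_nonneg s) (by linarith : (0 : ℝ) ≤ 2 + s)]
    have h2 : 0 ≤ (1 - s ^ 2 - s) ^ 2 + 4 * s ^ 2 := by positivity
    have h3 : (1 - s) * ((1 - s * m - (s + m) / 2) * (1 - s ^ 2 - s) + 2 * s * (s + m)) =
        (m - s) * (1 / 2 + 3 * s ^ 2 + 3 / 2 * s ^ 3) +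
          (1 - m) * ((1 - s ^ 2 - s) ^ 2 + 4 * s ^ 2) := by ring
    have h4 : 0 < (m - s) * (1 / 2 + 3 * s ^ 2 + 3 / 2 * s ^ 3) :=
      mul_pos (by linarith) h1
    have h5 : 0 ≤ (1 - m) * ((1 - s ^ 2 - s) ^ 2 + 4 * s ^ 2) :=
      mul_nonneg (by linarith) h2
    exact pos_of_mul_pos_right (by rw [h3]; linarith) (by linarith : (0 : ℝ) ≤ 1 - s)
  have hu0 : u 0 = 2 * s / (1 + s ^ 2) - u 1 / 2 := by linarith
  have hv0 : v 0 = 2 * m / (1 + m ^ 2) - v 1 / 2 := by linarith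
  have key : inner ℝ (v - u) (ellipseTangent u) =
      2 * (m - s) * ((1 - s * m - (s + m) / 2) * (1 - s ^ 2 - s) + 2 * s * (s + m)) /
        ((1 + s ^ 2) ^ 2 * (1 + m ^ 2)) := by
    rw [plane_inner]
    simp only [ellipseTangent, PiLp.sub_apply, PiLp.toLp_apply, Matrix.cons_val_zero,
      Matrix.cons_val_one]
    rw [hsX, hu0, hv0, hsY, hmY]
    have : 1 + s ^ 2 ≠ 0 := by positivity
    have : 1 + m ^ 2 ≠ 0 := by positivity
    field_simp
    ring
  rw [key]
  have : 0 < m - s := by linarith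
  positivity

lemma norm_sub_le_stereoParam {u v : Plane} (hu : ellipseForm u u = 1)
    (hv : ellipseForm v v = 1) (hu1 : u 1 ≤ 0) (hv1 : v 1 ≤ 0) :
    ‖v - u‖ ≤ 3 * |stereoParam v - stereoParam u| := by
  obtain ⟨-, -, hsX, hsY⟩ := stereoParam_spec hu hu1
  obtain ⟨-, -, hmX, hmY⟩ := stereoParam_spec hv hv1
  set s := stereoParam u
  set m := stereoParam v
  have h := norm_sq_le_ellipseForm (v - u)
  have key : ellipseForm (v - u) (v - u) = 4 * (m - s) ^ 2 / ((1 + s ^ 2) * (1 + m ^ 2)) := by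
    have : ellipseForm (v - u) (v - u) =
        ((v 0 + v 1 / 2) - (u 0 + u 1 / 2)) ^ 2 + (v 1 - u 1) ^ 2 := by
      simp only [ellipseForm, PiLp.sub_apply]; ring
    rw [this, hsX, hmX, hsY, hmY]
    have : 1 + s ^ 2 ≠ 0 := by positivity
    have : 1 + m ^ 2 ≠ 0 := by positivity
    field_simp
    ring
  have hle : ellipseForm (v - u) (v - u) ≤ 4 * (m - s) ^ 2 := by
    rw [key]
    apply div_le_self (by positivity)
    nlinarith [sq_nonneg s, sq_nonneg m, mul_nonneg (sq_nonneg s) (sq_nonneg m)]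
  refine abs_le_of_sq_le_sq' ?_ (by positivity) |>.2
  rw [mul_pow, sq_abs]
  nlinarith [sq_nonneg (m - s)]

/-- The diameter is at most 2√2, hence the bound 3 / c on the duration of a flight. -/
lemma norm_sub_lt_three {u v : Plane} (hu : ellipseForm u u ≤ 1) (hv : ellipseForm v v ≤ 1) :
    ‖v - u‖ < 3 := by
  have h1 := norm_sq_le_ellipseForm u
  have h2 := norm_sq_le_ellipseForm v
  have h3 := norm_sub_le v u
  nlinarith [norm_nonneg u, norm_nonneg v, sq_nonneg (‖u‖ - 3 / 2), sq_nonneg (‖v‖ - 3 / 2)]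

/-! ### Normals, and the local structure of rays. -/

lemma inner_ellipseTangent_eq_zero {y n : Plane} (hy : y ∈ frontier tiltedEllipse)
    (hn : IsOutwardUnitNormal tiltedEllipse y n) : inner ℝ (ellipseTangent y) n = 0 := by
  have hq := ellipseForm_of_mem_frontier hy
  set A := inner ℝ (ellipseTangent y) n with hA
  set B := inner ℝ y n with hB
  -- A tangential step s, pulled inwards by a term of order s², stays in the ellipse. Both signs of
  -- s are allowed, so the tangential component of n must vanish.
  have key : ∀ s : ℝ, s ≠ 0 → s ^ 2 < 1 / 4 → s * A ≤ 2 * s ^ 2 * B := by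
    intro s hs hs'
    have hz : y + (s • ellipseTangent y - (2 * s ^ 2) • y) ∈ tiltedEllipse := by
      have : ellipseForm (y + (s • ellipseTangent y - (2 * s ^ 2) • y))
          (y + (s • ellipseTangent y - (2 * s ^ 2) • y)) =
          ((1 - 2 * s ^ 2) ^ 2 + s ^ 2) * ellipseForm y y := by
        simp only [ellipseForm, ellipseTangent, PiLp.add_apply, PiLp.smul_apply, PiLp.sub_apply,
          smul_eq_mul, Matrix.cons_val_zero, Matrix.cons_val_one]
        ring
      change _ < (1 : ℝ)
      rw [this, hq]
      have : 0 < s ^ 2 := by positivity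
      nlinarith
    have h := hn.2 _ hz
    rw [add_sub_cancel_left, inner_sub_left, inner_smul_left, inner_smul_left] at h
    simpa using h
  by_contra hne
  have hK : 0 < 1 + |A| + |B| := by positivity
  set K := 1 + |A| + |B| with hKdef
  have hAK : A ^ 2 < K ^ 2 := by
    apply sq_lt_sq'
    · have := neg_abs_le A; have := abs_nonneg B; linarith
    · have := le_abs_self A; have := abs_nonneg B; linarith
  -- This s has the sign of A and is small enough for the linear term to beat the quadratic one.
  have h := key (A / (4 * K)) (by positivity) (by
    rw [div_pow, div_lt_iff₀ (by positivity)]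
    nlinarith)
  have hBK : B < K := by have := le_abs_self B; have := abs_nonneg A; linarith
  have hA2 : 0 < A ^ 2 := by positivity
  have e1 : A / (4 * K) * A = A ^ 2 / (16 * K ^ 2) * (4 * K) := by field_simp; ring
  have e2 : 2 * (A / (4 * K)) ^ 2 * B = A ^ 2 / (16 * K ^ 2) * (2 * B) := by field_simp; ring
  rw [e1, e2] at h
  have := le_of_mul_le_mul_left h (by positivity)
  linarith

lemma hasDerivWithinAt_of_eventually_affine {x : ℝ → Plane} {S : Set ℝ} {t : ℝ} {v : Plane}
    (h : ∀ᶠ s in 𝓝[S] t, x s = x t + (s - t) • v) : HasDerivWithinAt x v S t := by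
  have h1 : HasDerivAt (fun s : ℝ => x t + (s - t) • v) v t := by
    simpa using (((hasDerivAt_id t).sub_const t).smul_const v).const_add (x t)
  exact h1.hasDerivWithinAt.congr_of_eventuallyEq h (by simp)

lemma differentiableAt_of_eventually_affine {x : ℝ → Plane} {s t : ℝ} {a v : Plane}
    (h : ∀ᶠ r in 𝓝 s, x r = a + (r - t) • v) : DifferentiableAt ℝ x s := by
  have h1 : DifferentiableAt ℝ (fun r : ℝ => a + (r - t) • v) s := by fun_prop
  exact h1.congr_of_eventuallyEq h

/-- Continuity transfers a straight motion known only before s to the time s itself, with its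
velocity. -/
lemma affine_unique_left {x : ℝ → Plane} {s t : ℝ} {a v w : Plane}
    (hv : ∀ᶠ r in 𝓝[≤] s, x r = x s + (r - s) • v)
    (hw : ∀ᶠ r in 𝓝[<] s, x r = a + (r - t) • w) : v = w ∧ x s = a + (s - t) • w := by
  have hd := hasDerivWithinAt_of_eventually_affine hv
  have hc : Tendsto x (𝓝[<] s) (𝓝 (x s)) :=
    hd.continuousWithinAt.tendsto.mono_left (nhdsWithin_mono _ Iio_subset_Iic_self)
  have hc' : Tendsto (fun r : ℝ => a + (r - t) • w) (𝓝[<] s) (𝓝 (a + (s - t) • w)) := by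
    have : Continuous (fun r : ℝ => a + (r - t) • w) := by fun_prop
    exact (this.tendsto s).mono_left nhdsWithin_le_nhds
  have hs : x s = a + (s - t) • w :=
    tendsto_nhds_unique (hc.congr' hw) hc'
  refine ⟨?_, hs⟩
  have hw' : ∀ᶠ r in 𝓝[<] s, x r = x s + (r - s) • w := by
    filter_upwards [hw] with r hr
    rw [hr, hs]
    module
  have hd' := hasDerivWithinAt_of_eventually_affine hw'
  exact (uniqueDiffWithinAt_Iio s).eq_deriv _ (hd.mono Iio_subset_Iic_self) hd'

lemma IsReflectedAt.not_differentiableAt {Ω : Set Plane} {c t : ℝ} {x : ℝ → Plane}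
    (h : IsReflectedAt Ω c x t) : ¬ DifferentiableAt ℝ x t := by
  obtain ⟨-, n, v, hn, -, hvn, hl, hr⟩ := h
  intro hd
  have h1 := (uniqueDiffWithinAt_Iic t).eq_deriv _ (hasDerivWithinAt_of_eventually_affine hl)
    hd.hasDerivAt.hasDerivWithinAt
  have h2 := (uniqueDiffWithinAt_Ici t).eq_deriv _ (hasDerivWithinAt_of_eventually_affine hr)
    hd.hasDerivAt.hasDerivWithinAt
  rw [← h1, sub_eq_self, smul_eq_zero] at h2
  rcases h2 with h2 | h2
  · linarith
  · simp [h2] at hvn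

/-- Reflections are corners, so this excludes their accumulation from the left. -/
lemma IsRay.eventually_differentiableAt {Ω : Set Plane} {c T t : ℝ} {x : ℝ → Plane}
    (hx : IsRay Ω c T x) (ht : t ∈ Ioo 0 T) : ∀ᶠ s in 𝓝[<] t, DifferentiableAt ℝ x s := by
  rcases hx t ht with ⟨-, v, -, h⟩ | ⟨-, n, v, -, -, -, h, -⟩ | h
  · filter_upwards [h.eventually_nhds.filter_mono nhdsWithin_le_nhds] with s hs
    exact differentiableAt_of_eventually_affine hs
  · have h' := h.filter_mono (nhdsWithin_mono t Iio_subset_Iic_self)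
    filter_upwards [eventually_eventually_nhdsWithin.2 h', self_mem_nhdsWithin] with s hs hst
    rw [isOpen_Iio.nhdsWithin_eq hst] at hs
    exact differentiableAt_of_eventually_affine hs
  · exact (h.mono fun s hs => hs.2.1).filter_mono nhdsWithin_le_nhds

lemma IsRay.ellipseForm_le {c T t : ℝ} {x : ℝ → Plane} (hx : IsRay tiltedEllipse c T x)
    (ht : t ∈ Ioo 0 T) : ellipseForm (x t) (x t) ≤ 1 := by
  rcases hx t ht with h | h | h
  · exact le_of_lt h.1
  · exact (ellipseForm_of_mem_frontier h.1).le
  · exact (ellipseForm_of_mem_frontier h.self_of_nhds.1).le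

/-- Along a line the form is quadratic with positive leading coefficient, so it cannot equal 1 at
three equally spaced points. -/
lemma not_eventually_affine_mem_frontier {s t : ℝ} {a w : Plane} (hw : w ≠ 0) :
    ¬ ∀ᶠ r in 𝓝[<] s, a + (r - t) • w ∈ frontier tiltedEllipse := by
  intro h
  obtain ⟨l, hl, hl'⟩ := (mem_nhdsLT_iff_exists_Ioo_subset).1 h
  have hl : l < s := hl
  have e : ∀ θ : ℝ, 0 < θ → θ < 1 → ellipseForm (a + ((l + θ * (s - l)) - t) • w)
      (a + ((l + θ * (s - l)) - t) • w) = 1 := fun θ h0 h1 =>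
    ellipseForm_of_mem_frontier (hl' ⟨by nlinarith, by nlinarith⟩)
  have h1 := e (1 / 4) (by norm_num) (by norm_num)
  have h2 := e (1 / 2) (by norm_num) (by norm_num)
  have h3 := e (3 / 4) (by norm_num) (by norm_num)
  rw [ellipseForm_line] at h1 h2 h3
  have hq := ellipseForm_pos hw
  have : 0 < (s - l) ^ 2 * ellipseForm w w := mul_pos (pow_pos (by linarith) 2) hq
  nlinarith

/-! ### Straight flights between reflections. -/

/-- On the interval from `t` to `t'` the curve `x` is a straight line with velocity `w`. -/
def IsFlight (x : ℝ → Plane) (t t' : ℝ) (w : Plane) : Prop :=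
  t < t' ∧ ∀ s ∈ Icc t t', x s = x t + (s - t) • w

lemma IsRay.exists_flight {c T t : ℝ} {x : ℝ → Plane} {w : Plane}
    (hx : IsRay tiltedEllipse c T x) (hc : 0 < c) (ht0 : 0 < t) (htT : t + 3 / c < T)
    (hw : ‖w‖ = c) (h : ∀ᶠ s in 𝓝[≥] t, x s = x t + (s - t) • w) :
    ∃ t', t' ≤ t + 3 / c ∧ IsReflectedAt tiltedEllipse c x t' ∧ IsFlight x t t' w := by
  have h3 : 0 < 3 / c := by positivity
  have hw0 : w ≠ 0 := by
    rw [← norm_ne_zero_iff, hw]; exact hc.ne'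
  set S : Set ℝ := {s | t ≤ s ∧ s < T ∧ ∀ r ∈ Icc t s, x r = x t + (r - t) • w} with hS
  have hbd : ∀ s ∈ S, s < t + 3 / c := by
    rintro s ⟨hs1, hs2, hs3⟩
    have h1 := norm_sub_lt_three (hx.ellipseForm_le (t := t) ⟨ht0, by linarith⟩)
      (hx.ellipseForm_le (t := s) ⟨by linarith, hs2⟩)
    rw [hs3 s ⟨hs1, le_rfl⟩, add_sub_cancel_left, norm_smul, hw, Real.norm_eq_abs,
      abs_of_nonneg (by linarith)] at h1
    rw [← sub_lt_iff_lt_add', lt_div_iff₀ hc]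
    exact h1
  have hba : BddAbove S := ⟨t + 3 / c, fun s hs => (hbd s hs).le⟩
  obtain ⟨u, hu, hu'⟩ := (mem_nhdsGE_iff_exists_Icc_subset).1 h
  have hu : t < u := hu
  have hmem : min u (t + 1 / c) ∈ S := by
    have h31 : 1 / c < 3 / c := by gcongr; norm_num
    refine ⟨le_min hu.le (by linarith [one_div_pos.2 hc]), ?_, fun r hr => ?_⟩
    · exact (min_le_right _ _).trans_lt (by linarith)
    · exact hu' ⟨hr.1, hr.2.trans (min_le_left _ _)⟩
  -- At the supremal time a free ray could be prolonged, and gliding would put a segment in the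
  -- boundary; only reflection is left.
  set s₀ := sSup S with hs₀
  have hts : t < s₀ := (lt_min hu (by linarith [one_div_pos.2 hc])).trans_le (le_csSup hba hmem)
  have hs₀le : s₀ ≤ t + 3 / c := csSup_le ⟨_, hmem⟩ fun s hs => (hbd s hs).le
  have haff : ∀ r ∈ Ico t s₀, x r = x t + (r - t) • w := by
    intro r hr
    obtain ⟨s, hs, hrs⟩ := exists_lt_of_lt_csSup ⟨_, hmem⟩ hr.2
    exact hs.2.2 r ⟨hr.1, hrs.le⟩
  have hev : ∀ᶠ r in 𝓝[<] s₀, x r = x t + (r - t) • w := by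
    filter_upwards [Ico_mem_nhdsLT hts] with r hr using haff r hr
  rcases hx s₀ ⟨by linarith, by linarith⟩ with ⟨-, v, -, hv⟩ | hrefl | hgl
  · obtain ⟨rfl, hs⟩ := affine_unique_left (hv.filter_mono nhdsWithin_le_nhds) hev
    obtain ⟨ε, hε, hball⟩ := Metric.eventually_nhds_iff.1 hv
    set δ := min (ε / 2) ((T - s₀) / 2) with hδ
    have hδ0 : 0 < δ := lt_min (by linarith) (by linarith)
    have hin : s₀ + δ ∈ S := by
      refine ⟨by linarith, ?_, fun r hr => ?_⟩
      · have := min_le_right (ε / 2) ((T - s₀) / 2)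
        linarith
      · rcases lt_or_ge r s₀ with hlt | hge
        · exact haff r ⟨hr.1, hlt⟩
        · have h1 := hr.2
          have h2 := min_le_left (ε / 2) ((T - s₀) / 2)
          rw [hball (by rw [Real.dist_eq, abs_of_nonneg (by linarith)]; linarith), hs]
          module
    have := le_csSup hba hin
    linarith
  · refine ⟨s₀, hs₀le, hrefl, hts, fun r hr => ?_⟩
    rcases hr.2.lt_or_eq with hlt | rfl
    · exact haff r ⟨hr.1, hlt⟩
    · obtain ⟨-, n, v, -, -, -, hl, -⟩ := hrefl
      exact (affine_unique_left hl hev).2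
  · refine absurd ?_ (not_eventually_affine_mem_frontier (s := s₀) (t := t) (a := x t) hw0)
    filter_upwards [hev, (hgl.filter_mono nhdsWithin_le_nhds)] with r hr hr'
    rw [← hr]
    exact hr'.1

lemma norm_reflection {v n : Plane} (hn : ‖n‖ = 1) : ‖v - (2 * inner ℝ v n) • n‖ = ‖v‖ := by
  rw [← sq_eq_sq₀ (norm_nonneg _) (norm_nonneg _), norm_sub_sq_real, inner_smul_right, norm_smul,
    mul_pow, hn, Real.norm_eq_abs, sq_abs]
  ring

lemma IsRay.exists_flight_of_reflected {c T t : ℝ} {x : ℝ → Plane}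
    (hx : IsRay tiltedEllipse c T x) (hc : 0 < c) (ht0 : 0 < t) (htT : t + 3 / c < T)
    (h : IsReflectedAt tiltedEllipse c x t) :
    ∃ t', t' ≤ t + 3 / c ∧ IsReflectedAt tiltedEllipse c x t' ∧
      ∃ w : Plane, ‖w‖ = c ∧ IsFlight x t t' w := by
  obtain ⟨-, n, v, hn, hv, -, -, hr⟩ := h
  have hw := (norm_reflection hn.1 (v := v)).trans hv
  obtain ⟨t', h1, h2, h3⟩ := hx.exists_flight hc ht0 htT hw hr
  exact ⟨t', h1, h2, _, hw, h3⟩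

lemma IsFlight.inner_tangent_eq {c t₀ t₁ t₂ : ℝ} {x : ℝ → Plane} {w w' : Plane}
    (h : IsFlight x t₀ t₁ w) (h' : IsFlight x t₁ t₂ w')
    (hr : IsReflectedAt tiltedEllipse c x t₁) :
    inner ℝ w (ellipseTangent (x t₁)) = inner ℝ w' (ellipseTangent (x t₁)) := by
  obtain ⟨hf, n, v, hn, -, -, hl, hr⟩ := hr
  have h1 : v = w := (affine_unique_left hl (a := x t₀) (t := t₀) (by
    filter_upwards [Ico_mem_nhdsLT h.1] with r hr using h.2 r ⟨hr.1, hr.2.le⟩)).1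
  have h2 : v - (2 * inner ℝ v n) • n = w' :=
    (uniqueDiffWithinAt_Ici t₁).eq_deriv _ (hasDerivWithinAt_of_eventually_affine hr)
      (hasDerivWithinAt_of_eventually_affine (by
        filter_upwards [Icc_mem_nhdsGE h'.1] with r hr using h'.2 r hr))
  rw [← h2, ← h1, inner_sub_left, inner_smul_left, real_inner_comm _ n,
    inner_ellipseTangent_eq_zero hf hn]
  simp

/-- If the ray also left towards a larger parameter, the tangential velocity at `x t₁` would be
negative before the reflection and positive after it. -/
lemma IsFlight.no_left_turn {c t₀ t₁ t₂ : ℝ} {x : ℝ → Plane} {w w' : Plane}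
    (h : IsFlight x t₀ t₁ w) (h' : IsFlight x t₁ t₂ w')
    (hr : IsReflectedAt tiltedEllipse c x t₁)
    (hq₀ : ellipseForm (x t₀) (x t₀) = 1) (hq₂ : ellipseForm (x t₂) (x t₂) = 1)
    (h₀ : x t₀ 1 ≤ 0) (h₁ : x t₁ 1 ≤ 0) (h₂ : x t₂ 1 ≤ 0)
    (hlt : stereoParam (x t₁) < stereoParam (x t₀)) :
    stereoParam (x t₂) ≤ stereoParam (x t₁) := by
  by_contra! hlt'
  have hq₁ := ellipseForm_of_mem_frontier hr.1
  have e := h.inner_tangent_eq h' hr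
  have i₀ := inner_ellipseTangent_pos hq₁ hq₀ h₁ h₀ hlt
  have i₂ := inner_ellipseTangent_pos hq₁ hq₂ h₁ h₂ hlt'
  have a₀ : x t₀ - x t₁ = (-(t₁ - t₀)) • w := by
    rw [h.2 t₁ ⟨h.1.le, le_rfl⟩]; module
  have a₂ : x t₂ - x t₁ = (t₂ - t₁) • w' := by
    rw [h'.2 t₂ ⟨h'.1.le, le_rfl⟩]; module
  rw [a₀, inner_smul_left] at i₀
  rw [a₂, inner_smul_left, ← e] at i₂
  simp only [conj_trivial] at i₀ i₂
  have b₂ := pos_of_mul_pos_right i₂ (by linarith [h'.1])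
  nlinarith [h.1]

lemma IsFlight.duration_le {c t t' : ℝ} {x : ℝ → Plane} {w : Plane} (hw : ‖w‖ = c)
    (h : IsFlight x t t' w) (hq : ellipseForm (x t) (x t) = 1)
    (hq' : ellipseForm (x t') (x t') = 1) (h₀ : x t 1 ≤ 0) (h₁ : x t' 1 ≤ 0) :
    c * (t' - t) ≤ 3 * |stereoParam (x t') - stereoParam (x t)| := by
  refine le_trans (le_of_eq ?_) (norm_sub_le_stereoParam hq hq' h₀ h₁)
  rw [h.2 t' ⟨h.1.le, le_rfl⟩, add_sub_cancel_left, norm_smul, hw, Real.norm_eq_abs,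
    abs_of_nonneg (by linarith [h.1]), mul_comm]

/-! ### Time spent by a reflected ray on the lower arc. -/

lemma IsRay.not_strictMono_reflections {Ω : Set Plane} {c T b : ℝ} {x : ℝ → Plane}
    (hx : IsRay Ω c T x) {τ : ℕ → ℝ} (hτ : StrictMono τ) (h0 : 0 < τ 0) (hb : ∀ n, τ n ≤ b)
    (hbT : b < T) : ¬ ∀ n, IsReflectedAt Ω c x (τ n) := by
  intro hr
  have hbdd : BddAbove (range τ) := ⟨b, by rintro _ ⟨n, rfl⟩; exact hb n⟩
  have hlim := tendsto_atTop_ciSup hτ.monotone hbdd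
  have hlt : ∀ n, τ n < ⨆ i, τ i := fun n => (hτ n.lt_succ_self).trans_le (le_ciSup hbdd _)
  have hev := hx.eventually_differentiableAt
    ⟨h0.trans (hlt 0), (ciSup_le hb).trans_lt hbT⟩
  have hlim' : Tendsto τ atTop (𝓝[<] ⨆ i, τ i) :=
    tendsto_nhdsWithin_iff.2 ⟨hlim, Eventually.of_forall hlt⟩
  obtain ⟨n, hn⟩ := (hlim'.eventually hev).exists
  exact (hr n).not_differentiableAt hn

lemma IsRay.exists_reflection_pos {c T t₀ : ℝ} {x : ℝ → Plane}
    (hx : IsRay tiltedEllipse c T x) (hc : 0 < c) (ht₀ : 0 < t₀) (htT : t₀ + 18 / c < T)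
    (hr₀ : IsReflectedAt tiltedEllipse c x t₀) :
    ∃ t ∈ Ioo 0 T, IsReflectedAt tiltedEllipse c x t ∧ 0 < x t 1 := by
  by_contra! hneg
  have h1c : 0 < 1 / c := by positivity
  have e3 : 3 / c = 3 * (1 / c) := by ring
  have e18 : 18 / c = 18 * (1 / c) := by ring
  rw [e18] at htT
  -- The hypotheses are put under the existential so that `nxt` is total and can be iterated; its
  -- value elsewhere is irrelevant.
  have hstep : ∀ t : ℝ, ∃ t', 0 < t → t + 3 / c < T → IsReflectedAt tiltedEllipse c x t →
      t' ≤ t + 3 / c ∧ IsReflectedAt tiltedEllipse c x t' ∧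
        ∃ w : Plane, ‖w‖ = c ∧ IsFlight x t t' w := by
    intro t
    by_cases h : 0 < t ∧ t + 3 / c < T ∧ IsReflectedAt tiltedEllipse c x t
    · obtain ⟨t', ht'⟩ := hx.exists_flight_of_reflected hc h.1 h.2.1 h.2.2
      exact ⟨t', fun _ _ _ => ht'⟩
    · exact ⟨t, fun a b d => absurd ⟨a, b, d⟩ h⟩
  choose nxt hnxt using hstep
  set τ : ℕ → ℝ := fun n => nxt^[n] t₀ with hτ
  have hτs : ∀ n, τ (n + 1) = nxt (τ n) := fun n => Function.iterate_succ_apply' nxt n t₀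
  have hτ0 : τ 0 = t₀ := rfl
  have hbound : ∀ t ∈ Ioo 0 T, IsReflectedAt tiltedEllipse c x t →
      ellipseForm (x t) (x t) = 1 ∧ x t 1 ≤ 0 ∧
        -1 ≤ stereoParam (x t) ∧ stereoParam (x t) ≤ 1 := by
    intro t ht hr
    have hq := ellipseForm_of_mem_frontier hr.1
    have h1 := hneg t ht hr
    have := stereoParam_spec hq h1
    exact ⟨hq, h1, this.1, this.2.1⟩
  -- While the parameter m increases, the length travelled is at most 3 (m + 1). After the turn it
  -- is at most 3 (2 + (1 - m)) = 3 (3 - m). Either bound is at most 12.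
  have main : ∀ n, τ n ∈ Ioo 0 T ∧ τ (n + 1) ∈ Ioo 0 T ∧
      IsReflectedAt tiltedEllipse c x (τ n) ∧ IsReflectedAt tiltedEllipse c x (τ (n + 1)) ∧
      τ (n + 1) ≤ τ n + 3 / c ∧ (∃ w : Plane, ‖w‖ = c ∧ IsFlight x (τ n) (τ (n + 1)) w) ∧
      ((stereoParam (x (τ n)) < stereoParam (x (τ (n + 1))) ∧
          c * (τ n - t₀) ≤ 3 * (stereoParam (x (τ n)) + 1)) ∨
        (stereoParam (x (τ (n + 1))) < stereoParam (x (τ n)) ∧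
          c * (τ n - t₀) ≤ 3 * (3 - stereoParam (x (τ n))))) := by
    have hne : ∀ {t t' : ℝ}, t ∈ Ioo 0 T → t' ∈ Ioo 0 T → IsReflectedAt tiltedEllipse c x t →
        IsReflectedAt tiltedEllipse c x t' → (∃ w : Plane, ‖w‖ = c ∧ IsFlight x t t' w) →
        c * (t' - t) ≤ 3 * |stereoParam (x t') - stereoParam (x t)| ∧
        stereoParam (x t) ≠ stereoParam (x t') := by
      rintro t t' ht ht' hr hr' ⟨w, hw, hfl⟩
      obtain ⟨q, y, -, -⟩ := hbound t ht hr
      obtain ⟨q', y', -, -⟩ := hbound t' ht' hr'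
      have h := hfl.duration_le hw q q' y y'
      refine ⟨h, fun he => ?_⟩
      rw [he, sub_self, abs_zero, mul_zero] at h
      nlinarith [hfl.1]
    intro n
    induction n with
    | zero =>
      rw [hτs 0, hτ0]
      obtain ⟨h1, h2, h3⟩ := hnxt t₀ ht₀ (by linarith) hr₀
      have hlt : t₀ < nxt t₀ := h3.choose_spec.2.1
      have m0 : t₀ ∈ Ioo 0 T := ⟨ht₀, by linarith⟩
      have m1 : nxt t₀ ∈ Ioo 0 T := ⟨by linarith, by linarith⟩
      refine ⟨m0, m1, hr₀, h2, h1, h3, ?_⟩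
      obtain ⟨-, -, hb1, hb2⟩ := hbound t₀ m0 hr₀
      rw [sub_self, mul_zero]
      rcases (hne m0 m1 hr₀ h2 h3).2.lt_or_gt with h | h
      · exact Or.inl ⟨h, by linarith⟩
      · exact Or.inr ⟨h, by linarith⟩
    | succ n ih =>
      obtain ⟨m0, m1, r0, r1, hle, hfl, hφ⟩ := ih
      obtain ⟨q0, y0, a0, b0⟩ := hbound _ m0 r0
      obtain ⟨q1, y1, a1, b1⟩ := hbound _ m1 r1
      -- Two more flights of at most 3 / c each end before t₀ + 18 / c < T.
      have htime : τ n ≤ t₀ + 12 * (1 / c) := by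
        have : c * (τ n - t₀) ≤ 12 := by rcases hφ with h | h <;> linarith [h.2]
        have : τ n - t₀ ≤ 12 / c := by rw [le_div_iff₀ hc]; linarith
        have e12 : 12 / c = 12 * (1 / c) := by ring
        linarith
      obtain ⟨h1, h2, h3⟩ := hnxt (τ (n + 1)) m1.1 (by linarith) r1
      rw [← hτs] at h1 h2 h3
      have hlt : τ (n + 1) < τ (n + 1 + 1) := h3.choose_spec.2.1
      have m2 : τ (n + 1 + 1) ∈ Ioo 0 T := ⟨by linarith [m1.1], by linarith⟩
      refine ⟨m1, m2, r1, h2, h1, h3, ?_⟩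
      obtain ⟨q2, y2, a2, b2⟩ := hbound _ m2 h2
      have hd := (hne m0 m1 r0 r1 hfl).1
      have hn2 := (hne m1 m2 r1 h2 h3).2
      rcases hφ with ⟨hs, hc1⟩ | ⟨hs, hc1⟩
      · rw [abs_of_pos (by linarith)] at hd
        rcases hn2.lt_or_gt with h | h
        · exact Or.inl ⟨h, by linarith⟩
        · exact Or.inr ⟨h, by linarith⟩
      · rw [abs_of_neg (by linarith)] at hd
        obtain ⟨w, -, hw⟩ := hfl
        obtain ⟨w', -, hw'⟩ := h3
        have := hw.no_left_turn hw' r1 q0 q2 y0 y1 y2 hs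
        exact Or.inr ⟨lt_of_le_of_ne this hn2.symm, by linarith⟩
  refine hx.not_strictMono_reflections (τ := τ) (b := t₀ + 12 * (1 / c))
    (strictMono_nat_of_lt_succ fun n => (main n).2.2.2.2.2.1.choose_spec.2.1) ht₀ (fun n => ?_)
    (by linarith) fun n => (main n).2.2.1
  obtain ⟨m0, -, r0, -, -, -, hφ⟩ := main n
  obtain ⟨-, -, a0, b0⟩ := hbound _ m0 r0
  have : c * (τ n - t₀) ≤ 12 := by rcases hφ with h | h <;> linarith [h.2]
  have : τ n - t₀ ≤ 12 / c := by rw [le_div_iff₀ hc]; linarith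
  have e12 : 12 / c = 12 * (1 / c) := by ring
  linarith

/-! ### Non-diffractive meetings and gliding rays. -/

lemma IsReflectedAt.isNondiffractiveAt {Ω : Set Plane} {c t : ℝ} {x : ℝ → Plane}
    (h : IsReflectedAt Ω c x t) : IsNondiffractiveAt Ω x t := by
  obtain ⟨hf, n, v, hn, -, hvn, hl, -⟩ := h
  refine ⟨hf, v, (hasDerivWithinAt_of_eventually_affine hl).mono Iio_subset_Iic_self, ?_⟩
  filter_upwards [self_mem_nhdsWithin] with s hs hmem
  have hs : 0 < s := hs
  have hcl : IsClosed {z : Plane | inner ℝ (z - x t) n ≤ 0} :=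
    isClosed_le (by fun_prop) continuous_const
  have h := closure_minimal (fun z hz => hn.2 z hz) hcl hmem
  change inner ℝ (x t + s • v - x t) n ≤ (0 : ℝ) at h
  rw [add_sub_cancel_left, real_inner_smul_left] at h
  nlinarith

lemma IsGlidingAt.ellipseForm_deriv_eq_zero {c t : ℝ} {x : ℝ → Plane}
    (h : IsGlidingAt tiltedEllipse c x t) : ellipseForm (x t) (deriv x t) = 0 := by
  have hd := h.self_of_nhds.2.1.hasDerivAt
  have hcoord : ∀ i, HasDerivAt (fun s => x s i) (deriv x t i) t := fun i =>
    (EuclideanSpace.proj (𝕜 := ℝ) i).hasFDerivAt.comp_hasDerivAt t hd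
  have hX := (hcoord 0).add ((hcoord 1).div_const 2)
  have hq := (hX.pow 2).add ((hcoord 1).pow 2)
  have hconst := (hasDerivAt_const t (1 : ℝ)).congr_of_eventuallyEq
    (f₁ := fun s => (x s 0 + x s 1 / 2) ^ 2 + x s 1 ^ 2) (by
      filter_upwards [h] with s hs
      rw [← ellipseForm_of_mem_frontier hs.1, ellipseForm]
      ring)
  have e := hq.unique hconst
  simp only [Pi.add_apply] at e
  rw [ellipseForm]
  push_cast at e
  linarith

lemma IsGlidingAt.isNondiffractiveAt {c t : ℝ} {x : ℝ → Plane} (hc : 0 < c)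
    (h : IsGlidingAt tiltedEllipse c x t) : IsNondiffractiveAt tiltedEllipse x t := by
  obtain ⟨hf, hd, hn⟩ := h.self_of_nhds
  refine ⟨hf, deriv x t, hd.hasDerivAt.hasDerivWithinAt, ?_⟩
  filter_upwards [self_mem_nhdsWithin] with s hs hmem
  have hs : 0 < s := hs
  have hle := ellipseForm_le_of_mem_closure hmem
  rw [ellipseForm_line, ellipseForm_of_mem_frontier hf, h.ellipseForm_deriv_eq_zero] at hle
  have hv : deriv x t ≠ 0 := by rw [← norm_ne_zero_iff, hn]; exact hc.ne'
  have := mul_pos (pow_pos hs 2) (ellipseForm_pos hv)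
  linarith

/-- In the disc coordinates the velocity is l (-Y, X) with 2 l² ≥ c², and the parameter has
derivative l / (1 - Y) with 1 - Y ≤ 2. -/
lemma IsGlidingAt.exists_hasDerivAt_stereoParam {c t : ℝ} {x : ℝ → Plane} (hc : 0 < c)
    (h : IsGlidingAt tiltedEllipse c x t) (h1 : x t 1 ≤ 0) :
    ∃ d : ℝ, HasDerivAt (fun s => stereoParam (x s)) d t ∧ c / 3 ≤ |d| := by
  obtain ⟨hf, hd, hn⟩ := h.self_of_nhds
  have hcoord : ∀ i, HasDerivAt (fun s => x s i) (deriv x t i) t := fun i =>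
    (EuclideanSpace.proj (𝕜 := ℝ) i).hasFDerivAt.comp_hasDerivAt t hd.hasDerivAt
  have hY : 0 < 1 - x t 1 := by linarith
  have hg := ((hcoord 0).add ((hcoord 1).div_const 2)).div ((hcoord 1).const_sub 1) hY.ne'
  refine ⟨_, hg, ?_⟩
  have hq := ellipseForm_of_mem_frontier hf
  have hB := h.ellipseForm_deriv_eq_zero
  have hN := norm_sq_le_ellipseForm (deriv x t)
  rw [hn] at hN
  simp only [Pi.add_apply]
  rw [ellipseForm] at hq hB hN
  set X := x t 0 + x t 1 / 2
  set Y := x t 1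
  set V := deriv x t 0 + deriv x t 1 / 2
  set W := deriv x t 1
  have hV : V = -(X * W - Y * V) * Y := by linear_combination -V * hq + X * hB
  have hW : W = (X * W - Y * V) * X := by linear_combination -W * hq + Y * hB
  set l := X * W - Y * V with hl
  have hl2 : c ^ 2 ≤ 2 * l ^ 2 := by
    have : V * V + W * W = l ^ 2 := by
      rw [hV, hW]; linear_combination l ^ 2 * hq
    linarith
  have hval : (V * (1 - Y) - X * -W) / (1 - Y) ^ 2 = l / (1 - Y) := by
    have : V * (1 - Y) - X * -W = l * (1 - Y) := by linear_combination hV - hl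
    rw [this]; field_simp
  rw [hval, abs_div, abs_of_pos hY, le_div_iff₀ hY]
  have hY2 : 1 - Y ≤ 2 := by nlinarith [mul_self_nonneg X]
  have h3 : c * 2 / 3 ≤ |l| := by
    refine abs_le_of_sq_le_sq' ?_ (abs_nonneg l) |>.2
    rw [sq_abs]
    nlinarith [sq_nonneg c]
  nlinarith

lemma exists_gliding_pos {c b : ℝ} {x : ℝ → Plane} (hc : 0 < c) (hb : 9 / c < b)
    (h : ∀ t ∈ Ioo 0 b, IsGlidingAt tiltedEllipse c x t) : ∃ t ∈ Ioo 0 b, 0 < x t 1 := by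
  by_contra! hneg
  have h1c : 0 < 1 / c := by positivity
  have e9 : 9 / c = 9 * (1 / c) := by ring
  rw [e9] at hb
  choose! d hd hd' using fun t (ht : t ∈ Ioo 0 b) =>
    (h t ht).exists_hasDerivAt_stereoParam hc (hneg t ht)
  -- Over a time 7 / c the mean value theorem gives a parameter change of at least 7 / 3, more than
  -- the available 2. No continuity of the derivative is needed.
  have hsub : Icc (1 / c) (8 * (1 / c)) ⊆ Ioo 0 b := fun t ht =>
    ⟨by linarith [ht.1], by linarith [ht.2]⟩
  obtain ⟨ξ, hξ, he⟩ := exists_hasDerivAt_eq_slope (fun s => stereoParam (x s)) d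
    (by linarith : 1 / c < 8 * (1 / c))
    (fun t ht => (hd t (hsub ht)).continuousAt.continuousWithinAt)
    (fun t ht => hd t (hsub (Ioo_subset_Icc_self ht)))
  have hle := hd' ξ (hsub (Ioo_subset_Icc_self hξ))
  have hbd : ∀ t ∈ Ioo 0 b, |stereoParam (x t)| ≤ 1 := fun t ht => by
    have hs := stereoParam_spec
      (ellipseForm_of_mem_frontier (h t ht).self_of_nhds.1) (hneg t ht)
    exact abs_le.2 ⟨hs.1, hs.2.1⟩
  have b1 := hbd _ (hsub (left_mem_Icc.2 (by linarith)))
  have b2 := hbd _ (hsub (right_mem_Icc.2 (by linarith)))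
  have b3 := abs_sub (stereoParam (x (8 * (1 / c)))) (stereoParam (x (1 / c)))
  rw [he, abs_div, abs_of_pos (by linarith : 0 < 8 * (1 / c) - 1 / c),
    le_div_iff₀ (by linarith)] at hle
  have : c / 3 * (8 * (1 / c) - 1 / c) = 7 / 3 := by field_simp; norm_num
  linarith

lemma IsRay.exists_nondiffractive_pos {c : ℝ} {x : ℝ → Plane} (hc : 0 < c)
    (hx : IsRay tiltedEllipse c (42 / c) x) :
    ∃ t ∈ Ioo 0 (42 / c), 0 < x t 1 ∧ IsNondiffractiveAt tiltedEllipse x t := by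
  have h1c : 0 < 1 / c := by positivity
  have e3 : 3 / c = 3 * (1 / c) := by ring
  have e9 : 9 / c = 9 * (1 / c) := by ring
  have e18 : 18 / c = 18 * (1 / c) := by ring
  have e21 : 21 / c = 21 * (1 / c) := by ring
  have e42 : 42 / c = 42 * (1 / c) := by ring
  -- Here 42 = 21 + 3 + 18: a non-gliding time before 21 / c, a flight to a reflection, then the
  -- stay on the lower arc.
  have hrefl : ∀ t, 0 < t → t < 24 / c → IsReflectedAt tiltedEllipse c x t →
      ∃ t ∈ Ioo 0 (42 / c), 0 < x t 1 ∧ IsNondiffractiveAt tiltedEllipse x t := by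
    intro t ht0 ht h
    have e24 : 24 / c = 24 * (1 / c) := by ring
    obtain ⟨s, hs, hr, hpos⟩ := hx.exists_reflection_pos hc ht0 (by linarith) h
    exact ⟨s, hs, hpos, hr.isNondiffractiveAt⟩
  have e24 : 24 / c = 24 * (1 / c) := by ring
  by_cases hg : ∀ t ∈ Ioo 0 (21 / c), IsGlidingAt tiltedEllipse c x t
  · obtain ⟨t, ht, hpos⟩ := exists_gliding_pos hc (by linarith) hg
    exact ⟨t, ⟨ht.1, by linarith [ht.2]⟩, hpos, (hg t ht).isNondiffractiveAt hc⟩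
  · push Not at hg
    obtain ⟨t, ht, hng⟩ := hg
    rcases hx t ⟨ht.1, by linarith [ht.2]⟩ with ⟨-, v, hv, hf⟩ | h | h
    · obtain ⟨t', hle, hr, hfl⟩ := hx.exists_flight hc ht.1 (by linarith [ht.2]) hv
        (hf.filter_mono nhdsWithin_le_nhds)
      exact hrefl t' (ht.1.trans hfl.1) (by linarith [ht.2]) hr
    · exact hrefl t ht.1 (by linarith [ht.2]) h
    · exact absurd h hng

/-! ### Central symmetry and conclusion. -/

lemma neg_mem_tiltedEllipse {p : Plane} : -p ∈ tiltedEllipse ↔ p ∈ tiltedEllipse := by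
  have : ellipseForm (-p) (-p) = ellipseForm p p := by
    simp only [ellipseForm, PiLp.neg_apply]; ring
  simp [tiltedEllipse, this]

lemma neg_mem_frontier_tiltedEllipse {p : Plane} :
    -p ∈ frontier tiltedEllipse ↔ p ∈ frontier tiltedEllipse := by
  have h := (Homeomorph.neg Plane).preimage_frontier tiltedEllipse
  have h' : (Homeomorph.neg Plane) ⁻¹' tiltedEllipse = tiltedEllipse :=
    ext fun p => neg_mem_tiltedEllipse
  rw [h'] at h
  exact Set.ext_iff.1 h p

lemma IsRay.neg {c T : ℝ} {x : ℝ → Plane} (hx : IsRay tiltedEllipse c T x) :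
    IsRay tiltedEllipse c T (fun t => -x t) := by
  intro t ht
  rcases hx t ht with ⟨hm, v, hv, h⟩ | ⟨hm, n, v, hn, hv, hvn, hl, hr⟩ | h
  · refine Or.inl ⟨neg_mem_tiltedEllipse.2 hm, -v, by rwa [norm_neg], ?_⟩
    filter_upwards [h] with s hs
    rw [hs]; module
  · refine Or.inr (Or.inl ⟨neg_mem_frontier_tiltedEllipse.2 hm, -n, -v, ⟨by rw [norm_neg, hn.1],
      fun z hz => ?_⟩, by rwa [norm_neg], by rwa [inner_neg_neg], ?_, ?_⟩)
    · have := hn.2 (-z) (neg_mem_tiltedEllipse.2 hz)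
      rwa [← inner_neg_neg, neg_sub, sub_neg_eq_add, add_comm, ← sub_neg_eq_add] at this
    · filter_upwards [hl] with s hs
      rw [hs]; module
    · filter_upwards [hr] with s hs
      rw [hs, inner_neg_neg]; module
  · refine Or.inr (Or.inr ?_)
    filter_upwards [h] with s hs
    refine ⟨neg_mem_frontier_tiltedEllipse.2 hs.1, hs.2.1.neg, ?_⟩
    rw [deriv.fun_neg, norm_neg]
    exact hs.2.2

lemma IsRay.exists_nondiffractive_neg {c : ℝ} {x : ℝ → Plane} (hc : 0 < c)
    (hx : IsRay tiltedEllipse c (42 / c) x) :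
    ∃ t ∈ Ioo 0 (42 / c), x t 1 < 0 ∧ IsNondiffractiveAt tiltedEllipse x t := by
  obtain ⟨t, ht, hpos, hf, v, hv, hev⟩ := hx.neg.exists_nondiffractive_pos hc
  refine ⟨t, ht, by simpa using hpos, neg_mem_frontier_tiltedEllipse.1 hf, -v,
    by simpa using hv.fun_neg, ?_⟩
  have hcl : ∀ p : Plane, p ∈ closure tiltedEllipse → -p ∈ closure tiltedEllipse := fun p hp => by
    rw [closure_eq_self_union_frontier] at hp ⊢
    exact hp.imp neg_mem_tiltedEllipse.2 neg_mem_frontier_tiltedEllipse.2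
  filter_upwards [hev] with s hs hmem
  refine hs ?_
  have := hcl _ hmem
  rwa [neg_add, ← smul_neg, neg_neg] at this

theorem mainTheorem7 :
    ∃ Ω Γ : Set Plane, IsStrictlyConvexDomain Ω ∧ Γ ⊆ frontier Ω ∧
      ∀ c : ℝ, 0 < c →
        GeometricControlCondition Ω c Γ ∧ GeometricControlCondition Ω c (frontier Ω \ Γ) := by
  refine ⟨tiltedEllipse, frontier tiltedEllipse ∩ {p | 0 < p 1},
    isStrictlyConvexDomain_tiltedEllipse, inter_subset_left, fun c hc =>
      ⟨⟨42 / c, by positivity, fun x hx => ?_⟩, ⟨42 / c, by positivity, fun x hx => ?_⟩⟩⟩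
  · obtain ⟨t, ht, hpos, hnd⟩ := hx.exists_nondiffractive_pos hc
    refine ⟨t, ht, ⟨hnd.1, ?_⟩, hnd⟩
    have hopen : IsOpen {p : Plane | 0 < p 1} := isOpen_lt continuous_const (by fun_prop)
    exact inter_mem self_mem_nhdsWithin (mem_nhdsWithin_of_mem_nhds (hopen.mem_nhds hpos))
  · obtain ⟨t, ht, hneg, hnd⟩ := hx.exists_nondiffractive_neg hc
    refine ⟨t, ht, ⟨hnd.1, ?_⟩, hnd⟩
    have hopen : IsOpen {p : Plane | p 1 < 0} := isOpen_lt (by fun_prop) continuous_const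
    filter_upwards [self_mem_nhdsWithin, mem_nhdsWithin_of_mem_nhds (hopen.mem_nhds hneg)]
      with p hp hp1
    -- The two boundary points with p 1 = 0 also lie outside `Γ`, but the meetings used have p 1 <
    -- 0.
    exact ⟨hp, fun h => lt_asymm hp1 h.2⟩
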